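/- Let $F$ be a compact connected subset of $\mathbb{R}^2$ with empty interior which is not contained in a line. Then there exists a compact set $K\subset\mathbb{R}^2$ lying in a line such that $\mathbb{R}^2\setminus(F\cup K)$ has at least one bounded connected component. Moreover, if $\mathbb{R}^2\setminus F$ has no bounded connected component, then there is a point $z\in\partial(\mathrm{conv}(F))\setminus F$ such that $K$ can be chosen to be a non-degenerate closed line segment that contains $z$ and lies on a supporting line of the convex hull $\mathrm{conv}(F)$ through $z$, that is, a line $L$ with $z\in L$ such that $\mathrm{conv}(F)$ meets $L$ and lies in one of the two closed half-planes bounded by $L$. -/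

import Mathlib

/-- The subset `A` of the plane has at least one bounded connected component. -/
def HasBoundedComponent (A : Set (EuclideanSpace ℝ (Fin 2))) : Prop :=
  ∃ x ∈ A, Bornology.IsBounded (connectedComponentIn A x)

/-- `L` is a line that meets `C` and has `C` in one of its two closed half-planes. -/
def IsSupportingLine (C L : Set (EuclideanSpace ℝ (Fin 2))) : Prop :=
  ∃ (n : EuclideanSpace ℝ (Fin 2)) (c : ℝ), n ≠ 0 ∧ L = {x | inner ℝ n x = c} ∧
    (C ∩ L).Nonempty ∧ ∀ x ∈ C, inner ℝ n x ≤ c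

/-! If the complement of `F` has a bounded component, `K = ∅` works. Otherwise `F` cannot contain
the frontier of its hull: that frontier would enclose a component, as `F` has empty interior. Take a
frontier point `z ∉ F` and a supporting line at `z`; it meets `F` on both sides of `z`, at `p` and
`q`.

Adding the segment `[p, q]` separates. If all components were unbounded, there would be only one, so
a path off `F ∪ [p, q]` would join the two sides of the segment at `z`. Connectedness of `F` gives
`(w - p) / (w - q)` a continuous logarithm on this path together with a short transversal through
`z`. The principal logarithm is also continuous along the path but jumps by `2πi` along the
transversal, a contradiction (`separates_of_isPreconnected_union_segment`). -/

/-! ### Logarithms of quotients and separation -/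

open Complex in
lemma exists_log_div_of_isPreconnected {F D : Set ℂ} (hF : IsPreconnected F) (hD : IsClosed D)
    (hFD : Disjoint F D) {a b : ℂ} (ha : a ∈ F) (hb : b ∈ F) :
    ∃ h : ℂ → ℂ, ContinuousOn h D ∧ ∀ w ∈ D, exp (h w) = (w - a) / (w - b) := by
  have hne : ∀ x ∈ F, ∀ w ∈ D, w - x ≠ 0 := fun x hx w hw h ↦
    hFD.le_bot ⟨hx, by rwa [← sub_eq_zero.1 h]⟩
  -- Having such a logarithm is an equivalence relation on pairs in `F`. Nearby points are related
  -- because the quotient stays within distance 1 of 1.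
  refine hF.induction₂ (fun x y ↦ ∃ h : ℂ → ℂ, ContinuousOn h D ∧
    ∀ w ∈ D, exp (h w) = (w - x) / (w - y)) ?_ ?_ ?_ ha hb
  · intro x hx
    have hxD : x ∈ Dᶜ := fun h ↦ hFD.le_bot ⟨hx, h⟩
    obtain ⟨r, hr, hrD⟩ := Metric.isOpen_iff.1 hD.isOpen_compl x hxD
    filter_upwards [mem_nhdsWithin_of_mem_nhds (Metric.ball_mem_nhds x (half_pos hr)),
      self_mem_nhdsWithin] with y hy hyF
    have hslit : ∀ w ∈ D, (w - x) / (w - y) ∈ slitPlane := by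
      intro w hw
      have h0 := hne y hyF w hw
      have h1 : (w - x) / (w - y) = 1 + (y - x) / (w - y) := by field_simp; ring
      rw [h1]
      apply mem_slitPlane_of_norm_lt_one
      have hwx : r ≤ dist w x := not_lt.1 fun h ↦ hrD h hw
      have hwy := dist_triangle w y x
      rw [Metric.mem_ball] at hy
      rw [norm_div, div_lt_one (norm_pos_iff.2 h0), ← dist_eq_norm, ← dist_eq_norm]
      linarith
    refine ⟨fun w ↦ log ((w - x) / (w - y)), ContinuousOn.clog (ContinuousOn.div (by fun_prop)
      (by fun_prop) (hne y hyF)) hslit, fun w hw ↦ exp_log (slitPlane_ne_zero (hslit w hw))⟩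
  · rintro x y z - hy - ⟨h, hc, he⟩ ⟨k, kc, ke⟩
    refine ⟨fun w ↦ h w + k w, hc.add kc, fun w hw ↦ ?_⟩
    rw [exp_add, he w hw, ke w hw, div_mul_div_cancel₀ (hne y hy w hw)]
  · rintro x y - - ⟨h, hc, he⟩
    refine ⟨fun w ↦ -h w, hc.neg, fun w hw ↦ ?_⟩
    rw [exp_neg, he w hw, inv_div]

-- The difference takes values in one fibre of `exp`, which is discrete.
open Complex in
lemma log_sub_eq_log_sub_of_isPreconnected {S : Set ℂ} (hS : IsPreconnected S) {f h : ℂ → ℂ}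
    (hf : ContinuousOn f S) (hfS : ∀ w ∈ S, f w ∈ slitPlane) (hh : ContinuousOn h S)
    {c : ℂ} (hfh : ∀ w ∈ S, f w = c * exp (h w)) {p q : ℂ} (hp : p ∈ S) (hq : q ∈ S) :
    log (f p) - h p = log (f q) - h q := by
  refine isCoveringMap_exp.isSeparatedMap.constOn_of_comp
    isCoveringMap_exp.isLocalHomeomorph.isLocallyInjective hS
    (g := fun w ↦ log (f w) - h w) ((hf.clog hfS).sub hh) ?_ hp hq
  have key : ∀ w ∈ S, exp (log (f w) - h w) = c := fun w hw ↦ by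
    rw [exp_sub, exp_log (slitPlane_ne_zero (hfS w hw)), hfh w hw,
      mul_div_cancel_right₀ _ (exp_ne_zero _)]
  intro w hw w' hw'
  simp only [key w hw, key w' hw']

open Complex in
lemma div_sub_one_mem_slitPlane {u : ℂ} (hu : u ∉ segment ℝ (0 : ℂ) 1) :
    u / (u - 1) ∈ slitPlane := by
  by_contra h
  have h1 : u - 1 ≠ 0 := fun h1 ↦ hu (by rw [sub_eq_zero.1 h1]; exact right_mem_segment ℝ _ _)
  rw [mem_slitPlane_iff] at h
  push Not at h
  obtain ⟨hre, him⟩ := h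
  set r := (u / (u - 1)).re with hr
  have hur : u / (u - 1) = (r : ℂ) := Complex.ext rfl (by simpa using him)
  have hu' : u = ((r / (r - 1) : ℝ) : ℂ) := by
    have h2 : (r : ℂ) - 1 ≠ 0 := by
      have : r - 1 ≠ 0 := by linarith
      exact_mod_cast this
    rw [div_eq_iff h1] at hur
    push_cast
    rw [eq_div_iff h2]
    linear_combination -hur
  have hr1 : r - 1 < 0 := by linarith
  apply hu
  rw [segment_eq_image]
  refine ⟨r / (r - 1), ⟨div_nonneg_of_nonpos hre hr1.le, ?_⟩, ?_⟩
  · rw [div_le_one_of_neg hr1]; linarith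
  · rw [hu']; simp

-- On the transversal the quotient leaves the slit plane at `t = 0`, but its negative does not. The
-- signs tell how the two arguments differ at the ends.
open Complex in
lemma div_sub_one_neg_mem_slitPlane {s t : ℝ} (hs0 : 0 < s) (hs1 : s < 1) :
    -((s + t * I : ℂ) / (s + t * I - 1)) ∈ slitPlane ∧
      (0 < t → ((s + t * I : ℂ) / (s + t * I - 1)).im < 0) ∧
      (t < 0 → 0 < ((s + t * I : ℂ) / (s + t * I - 1)).im) := by
  have hN : 0 < normSq (s + t * I - 1 : ℂ) := by
    simp only [normSq_apply, sub_re, add_re, ofReal_re, mul_re, I_re, ofReal_im, I_im, one_re,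
      sub_im, add_im, mul_im, one_im]
    nlinarith [mul_pos (sub_pos.2 hs1) (sub_pos.2 hs1), mul_self_nonneg t]
  have him : ((s + t * I : ℂ) / (s + t * I - 1)).im = -t / normSq (s + t * I - 1 : ℂ) := by
    simp [div_im]; ring
  have hre : ((s + t * I : ℂ) / (s + t * I - 1)).re =
      (s * (s - 1) + t * t) / normSq (s + t * I - 1 : ℂ) := by
    simp [div_re]; ring
  refine ⟨?_, fun ht ↦ ?_, fun ht ↦ ?_⟩
  · rw [mem_slitPlane_iff, neg_re, neg_im, hre, him]
    by_cases ht : t = 0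
    · left
      rw [ht, mul_zero, add_zero, ← neg_div]
      rw [ht] at hN
      exact div_pos (by nlinarith) hN
    · right
      exact neg_ne_zero.2 (div_ne_zero (neg_ne_zero.2 ht) hN.ne')
  · rw [him]; exact div_neg_of_neg_of_pos (by linarith) hN
  · rw [him]; exact div_pos (by linarith) hN

open Complex in
/-- A connected set `F` through the endpoints of a segment separates, together with the segment,
the two sides of the segment near any interior point having a transversal that avoids `F`. -/
lemma separates_of_isPreconnected_union_segment {F C : Set ℂ} (hF : IsPreconnected F)
    {a b : ℂ} (ha : a ∈ F) (hb : b ∈ F) (hab : a ≠ b) {s ε : ℝ} (hs0 : 0 < s) (hs1 : s < 1)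
    (hε : 0 < ε)
    (hsF : ∀ t : ℝ, |t| ≤ ε → a + (s + t * I) * (b - a) ∉ F)
    (hC : IsCompact C) (hC' : IsPreconnected C) (hCF : Disjoint C (F ∪ segment ℝ a b))
    (hp : a + (s + ε * I) * (b - a) ∈ C) (hq : a + (s + (-ε : ℝ) * I) * (b - a) ∈ C) : False := by
  have hba : b - a ≠ 0 := sub_ne_zero.2 hab.symm
  set T : Set ℂ := (fun t : ℝ ↦ a + (s + t * I) * (b - a)) '' Set.Icc (-ε) ε with hT
  have hTc : IsCompact T := isCompact_Icc.image (by fun_prop)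
  have hTp : IsPreconnected T := isPreconnected_Icc.image _ (by fun_prop)
  have hTF : Disjoint F T := by
    rw [Set.disjoint_right]
    rintro _ ⟨t, ht, rfl⟩
    exact hsF t (abs_le.2 ht)
  have hCF' : Disjoint F C := (hCF.mono_right Set.subset_union_left).symm
  obtain ⟨h, hc, he⟩ := exists_log_div_of_isPreconnected hF (hC.union hTc).isClosed
    (hCF'.union_right hTF) ha hb
  have hne : ∀ w ∈ C ∪ T, w - b ≠ 0 := fun w hw h ↦
    (hCF'.union_right hTF).le_bot ⟨hb, by rwa [← sub_eq_zero.1 h]⟩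
  have hfc : ContinuousOn (fun w ↦ (w - a) / (w - b)) (C ∪ T) :=
    ContinuousOn.div (by fun_prop) (by fun_prop) hne
  have hf : ∀ u : ℂ, (a + u * (b - a) - a) / (a + u * (b - a) - b) = u / (u - 1) := fun u ↦ by
    rw [show a + u * (b - a) - a = u * (b - a) by ring,
      show a + u * (b - a) - b = (u - 1) * (b - a) by ring, mul_div_mul_right _ _ hba]
  have e1 := log_sub_eq_log_sub_of_isPreconnected hC' (hfc.mono Set.subset_union_left)
    (fun w hw ↦ ?_) (hc.mono Set.subset_union_left) (c := 1)
    (fun w hw ↦ by rw [one_mul, he w (Or.inl hw)]) hp hq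
  swap
  · have hw' : w = a + ((w - a) / (b - a)) * (b - a) := by field_simp; ring
    rw [hw', hf]
    apply div_sub_one_mem_slitPlane
    intro hmem
    refine hCF.le_bot ⟨hw, Or.inr ?_⟩
    rw [segment_eq_image] at hmem ⊢
    obtain ⟨θ, hθ, hθ'⟩ := hmem
    refine ⟨θ, hθ, ?_⟩
    rw [hw', ← hθ']
    simp only [real_smul, mul_zero, mul_one, zero_add]
    push_cast
    ring
  have hpT : a + (s + ε * I) * (b - a) ∈ T := ⟨ε, ⟨by linarith, le_rfl⟩, rfl⟩
  have hqT : a + (s + (-ε : ℝ) * I) * (b - a) ∈ T := ⟨-ε, ⟨le_rfl, by linarith⟩, rfl⟩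
  have e2 := log_sub_eq_log_sub_of_isPreconnected hTp (hfc.mono Set.subset_union_right).neg
    (fun w hw ↦ ?_) (hc.mono Set.subset_union_right) (c := -1)
    (fun w hw ↦ by rw [neg_one_mul, he w (Or.inr hw)]; rfl) hpT hqT
  swap
  · obtain ⟨t, -, rfl⟩ := hw
    simp only [Pi.neg_apply]
    rw [hf]
    exact (div_sub_one_neg_mem_slitPlane hs0 hs1).1
  simp only [Pi.neg_apply, hf] at e1 e2
  have hP := (div_sub_one_neg_mem_slitPlane (t := ε) hs0 hs1).2.1 hε
  have hQ := (div_sub_one_neg_mem_slitPlane (t := -ε) hs0 hs1).2.2 (by linarith)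
  have i1 := congrArg Complex.im e1
  have i2 := congrArg Complex.im e2
  simp only [sub_im, log_im] at i1 i2
  -- Passing from `f` to `-f` shifts the argument by `π` at one end and by `-π` at the other, so
  -- `i1` and `i2` differ by `2π`.
  rw [arg_neg_eq_arg_add_pi_of_im_neg hP, arg_neg_eq_arg_sub_pi_of_im_pos hQ] at i2
  linarith [Real.pi_pos]

/-! ### Bounded and unbounded components -/

lemma isPreconnected_compl_closedBall_zero {E : Type*} [NormedAddCommGroup E] [NormedSpace ℝ E]
    (h : 1 < Module.rank ℝ E) {R : ℝ} (hR : 0 ≤ R) :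
    IsPreconnected (Metric.closedBall (0 : E) R)ᶜ := by
  have himage : (fun x : ℝ × E ↦ x.1 • x.2) '' (Set.Ioi R ×ˢ Metric.sphere 0 1) =
      (Metric.closedBall (0 : E) R)ᶜ := by
    ext y
    simp only [Set.mem_image, Set.mem_prod, Set.mem_Ioi, mem_sphere_zero_iff_norm,
      Set.mem_compl_iff, mem_closedBall_zero_iff, not_le, Prod.exists]
    constructor
    · rintro ⟨t, x, ⟨ht, hx⟩, rfl⟩
      rwa [norm_smul, hx, mul_one, Real.norm_of_nonneg (hR.trans ht.le)]
    · intro hy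
      have hy0 : ‖y‖ ≠ 0 := (hR.trans_lt hy).ne'
      refine ⟨‖y‖, ‖y‖⁻¹ • y, ⟨hy, ?_⟩, smul_inv_smul₀ hy0 y⟩
      rw [norm_smul, norm_inv, norm_norm, inv_mul_cancel₀ hy0]
  rw [← himage]
  exact (isPreconnected_Ioi.prod (isPreconnected_sphere h 0 1)).image _ (by fun_prop)

/-- Two unbounded components of the complement of a bounded set coincide in dimension at least two. -/
lemma connectedComponentIn_compl_eq_of_not_isBounded {E : Type*} [NormedAddCommGroup E]
    [NormedSpace ℝ E] (h : 1 < Module.rank ℝ E) {A : Set E} (hA : Bornology.IsBounded A) {p q : E}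
    (hp : ¬ Bornology.IsBounded (connectedComponentIn Aᶜ p))
    (hq : ¬ Bornology.IsBounded (connectedComponentIn Aᶜ q)) :
    connectedComponentIn Aᶜ p = connectedComponentIn Aᶜ q := by
  obtain ⟨R, hR⟩ := hA.subset_closedBall (0 : E)
  have hR' : A ⊆ Metric.closedBall 0 (max R 0) :=
    hR.trans (Metric.closedBall_subset_closedBall (le_max_left _ _))
  have far : ∀ x, ¬ Bornology.IsBounded (connectedComponentIn Aᶜ x) →
      ∃ y ∈ connectedComponentIn Aᶜ x, y ∈ (Metric.closedBall (0 : E) (max R 0))ᶜ := by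
    intro x hx
    by_contra! hcon
    exact hx (Metric.isBounded_closedBall.subset fun y hy ↦ not_not.1 (hcon y hy))
  obtain ⟨y, hy, hyR⟩ := far p hp
  obtain ⟨w, hw, hwR⟩ := far q hq
  rw [connectedComponentIn_eq hy, connectedComponentIn_eq hw]
  exact connectedComponentIn_eq ((isPreconnected_compl_closedBall_zero h
    (le_max_right R 0)).subset_connectedComponentIn hyR (Set.compl_subset_compl.2 hR') hwR)

/-- A component starting in `interior S` off `F` cannot cross the frontier of `S`. -/
lemma hasBoundedComponent_compl_of_frontier_subset {F S : Set (EuclideanSpace ℝ (Fin 2))}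
    (hF : interior F = ∅) (hS : Bornology.IsBounded S) (hSi : (interior S).Nonempty)
    (hSF : frontier S ⊆ F) : HasBoundedComponent Fᶜ := by
  obtain ⟨x, hxS, hxF⟩ : ∃ x ∈ interior S, x ∉ F := by
    by_contra! hcon
    have := hSi.mono (interior_maximal hcon isOpen_interior)
    simp [hF] at this
  refine ⟨x, hxF, hS.subset (Set.Subset.trans ?_ interior_subset)⟩
  refine isPreconnected_connectedComponentIn.subset_left_of_subset_union isOpen_interior
    (isClosed_closure (s := S)).isOpen_compl ?_ ?_ ⟨x, mem_connectedComponentIn hxF, hxS⟩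
  · exact Set.disjoint_left.2 fun y hy hy' ↦ hy' (subset_closure (interior_subset hy))
  · intro y hy
    by_contra hcon
    rw [Set.mem_union, not_or, Set.mem_compl_iff, not_not] at hcon
    exact connectedComponentIn_subset _ _ hy (hSF ⟨hcon.2, hcon.1⟩)

/-! ### Supporting lines and segments -/

lemma interior_convexHull_nonempty_of_not_collinear {F : Set (EuclideanSpace ℝ (Fin 2))}
    (hne : F.Nonempty) (hF : ¬ Collinear ℝ F) : (interior (convexHull ℝ F)).Nonempty := by
  rw [interior_convexHull_nonempty_iff_affineSpan_eq_top,
    AffineSubspace.affineSpan_eq_top_iff_vectorSpan_eq_top_of_nonempty ℝ _ _ hne]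
  rw [collinear_iff_finrank_le_one, not_le] at hF
  apply Submodule.eq_top_of_finrank_eq
  have h1 := Submodule.finrank_le (vectorSpan ℝ F)
  rw [finrank_euclideanSpace_fin] at h1 ⊢
  omega

lemma exists_inner_le_of_mem_frontier {E : Type*} [NormedAddCommGroup E] [InnerProductSpace ℝ E]
    [CompleteSpace E] {S : Set E} (hS : Convex ℝ S) (hSi : (interior S).Nonempty) {z : E}
    (hz : z ∈ frontier S) : ∃ n : E, n ≠ 0 ∧ ∀ x ∈ S, inner ℝ n x ≤ inner ℝ n z := by
  obtain ⟨f, hf⟩ := geometric_hahn_banach_open_point hS.interior isOpen_interior hz.2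
  have hn : ∀ x, inner ℝ ((InnerProductSpace.toDual ℝ E).symm f) x = f x := fun x ↦ by simp
  refine ⟨(InnerProductSpace.toDual ℝ E).symm f, fun h0 ↦ ?_, fun x hx ↦ ?_⟩
  · obtain ⟨y, hy⟩ := hSi
    have := hf y hy
    rw [← hn, ← hn, h0, inner_zero_left, inner_zero_left] at this
    exact this.false
  · rw [hn, hn]
    have hx' : x ∈ closure (interior S) := by
      rw [hS.closure_interior_eq_closure_of_nonempty_interior hSi]
      exact subset_closure hx
    exact closure_minimal (t := {x | f x ≤ f z}) (fun y hy ↦ (hf y hy).le)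
      (isClosed_le f.continuous continuous_const) hx'

/-- A point of the closed hull of a compact set `F` on a supporting hyperplane has points of `F` in
the hyperplane weakly ahead of it in every direction. -/
lemma exists_mem_inner_eq_of_mem_closure_convexHull {E : Type*} [NormedAddCommGroup E]
    [InnerProductSpace ℝ E] {F : Set E} (hF : IsCompact F) {z n : E} (v : E)
    (hz : z ∈ closure (convexHull ℝ F)) (hn : ∀ x ∈ F, inner ℝ n x ≤ inner ℝ n z) :
    ∃ x ∈ F, inner ℝ n x = inner ℝ n z ∧ inner ℝ v z ≤ inner ℝ v x := by
  -- Otherwise the part of `F` weakly ahead lies at a positive gap `η` below the hyperplane, and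
  -- tilting `n` slightly to `n + δ • v` strictly separates `z` from `F`.
  by_contra! hcon
  have hG : IsCompact (F ∩ {x | inner ℝ v z ≤ inner ℝ v x}) :=
    hF.inter_right (isClosed_le continuous_const (by fun_prop))
  obtain ⟨η, hη, hηG⟩ := hG.exists_forall_le' (f := fun x ↦ inner ℝ n z - inner ℝ n x) (a := 0)
    (by fun_prop) fun x hx ↦ sub_pos.2 <| lt_of_le_of_ne (hn x hx.1) fun h ↦
      (hcon x hx.1 h).not_ge hx.2
  obtain ⟨M, hM⟩ := hF.exists_bound_of_continuousOn (f := fun x ↦ inner ℝ v x - inner ℝ v z)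
    (by fun_prop)
  have hM1 : 0 < |M| + 1 := by positivity
  set δ := η / (|M| + 1) with hδ
  have hδ0 : 0 < δ := div_pos hη hM1
  have hδM : δ * (|M| + 1) = η := div_mul_cancel₀ η hM1.ne'
  have hu : ∀ x ∈ F, 0 < inner ℝ (n + δ • v) z - inner ℝ (n + δ • v) x := by
    intro x hx
    simp only [inner_add_left, real_inner_smul_left]
    rcases le_or_gt (inner ℝ v z) (inner ℝ v x) with h | h
    · have h1 := hηG x ⟨hx, h⟩
      have h2 := (le_abs_self _).trans ((hM x hx).trans (le_abs_self M))
      nlinarith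
    · have h1 := hn x hx
      nlinarith
  obtain ⟨κ, hκ, hκF⟩ := hF.exists_forall_le' (by fun_prop) hu
  have hsub : closure (convexHull ℝ F) ⊆
      {x | inner ℝ (n + δ • v) x ≤ inner ℝ (n + δ • v) z - κ} :=
    closure_minimal (convexHull_min (fun x hx ↦ by
        have := hκF x hx
        rw [Set.mem_ofPred_eq]
        linarith)
      (convex_halfSpace_le (innerₗ E (n + δ • v)).isLinear _))
      (isClosed_le (by fun_prop) continuous_const)
  have := hsub hz
  rw [Set.mem_ofPred_eq] at this
  linarith

/-- A compact connected planar set becomes separating once we add a segment that joins two of its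
points through a point outside it. -/
lemma hasBoundedComponent_compl_union_segment {F : Set (EuclideanSpace ℝ (Fin 2))}
    (hF : IsCompact F) (hF' : IsPreconnected F) {a b z : EuclideanSpace ℝ (Fin 2)}
    (ha : a ∈ F) (hb : b ∈ F) (hz : z ∈ openSegment ℝ a b) (hzF : z ∉ F) :
    HasBoundedComponent (F ∪ segment ℝ a b)ᶜ := by
  have hab : a ≠ b := by
    rintro rfl
    rw [openSegment_same] at hz
    exact hzF (hz ▸ ha)
  let e : EuclideanSpace ℝ (Fin 2) ≃ₗᵢ[ℝ] ℂ := Complex.orthonormalBasisOneI.repr.symm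
  have heab : e a ≠ e b := e.injective.ne hab
  rw [openSegment_eq_image'] at hz
  obtain ⟨s, ⟨hs0, hs1⟩, rfl⟩ := hz
  have hsegc : IsCompact (segment ℝ a b) := by
    rw [segment_eq_image']
    exact isCompact_Icc.image (by fun_prop)
  have hAc : IsCompact (F ∪ segment ℝ a b) := hF.union hsegc
  set A := F ∪ segment ℝ a b with hA
  -- The perpendicular to the segment at `z`, in units of its length.
  let g : ℝ → EuclideanSpace ℝ (Fin 2) := fun t ↦
    e.symm (e a + (s + t * Complex.I) * (e b - e a))
  have heg : ∀ t, e (g t) = e a + (s + t * Complex.I) * (e b - e a) := fun t ↦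
    e.apply_symm_apply _
  have hgc : Continuous g := e.symm.continuous.comp (by fun_prop)
  have hg0 : g 0 = a + s • (b - a) := by
    apply e.injective
    rw [heg]
    simp
  obtain ⟨ε, hε, hεF⟩ : ∃ ε > 0, ∀ t : ℝ, |t| ≤ ε → g t ∉ F := by
    have hnhds : g ⁻¹' Fᶜ ∈ nhds (0 : ℝ) :=
      hgc.continuousAt (hF.isClosed.isOpen_compl.mem_nhds (by rwa [hg0]))
    obtain ⟨ε, hε, h⟩ := Metric.nhds_basis_closedBall.mem_iff.1 hnhds
    exact ⟨ε, hε, fun t ht ↦ h (by simpa using ht)⟩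
  have hgA : ∀ t, t ≠ 0 → |t| ≤ ε → g t ∈ Aᶜ := by
    rintro t ht htε (h | h)
    · exact hεF t htε h
    · rw [segment_eq_image'] at h
      obtain ⟨θ, -, hθ⟩ := h
      have h1 := congrArg e hθ
      simp only at h1
      rw [heg, map_add, map_smul, map_sub, add_right_inj, Complex.real_smul] at h1
      have h2 := mul_right_cancel₀ (sub_ne_zero.2 heab.symm) h1
      have h3 := congrArg Complex.im h2
      simp at h3
      exact ht h3.symm
  have hpA := hgA ε hε.ne' (abs_of_pos hε).le
  have hqA := hgA (-ε) (neg_ne_zero.2 hε.ne') (by rw [abs_neg, abs_of_pos hε])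
  unfold HasBoundedComponent
  by_contra! hcon
  have hrank : 1 < Module.rank ℝ (EuclideanSpace ℝ (Fin 2)) := by
    rw [← Module.finrank_eq_rank, finrank_euclideanSpace_fin]
    norm_num
  have heq := connectedComponentIn_compl_eq_of_not_isBounded hrank hAc.isBounded
    (hcon _ hpA) (hcon _ hqA)
  -- A path supplies the compact connected set that the separation lemma needs.
  have hpath : IsPathConnected (connectedComponentIn Aᶜ (g ε)) :=
    (hAc.isClosed.isOpen_compl.connectedComponentIn.isConnected_iff_isPathConnected).1
      (isConnected_connectedComponentIn_iff.2 hpA)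
  obtain ⟨γ, hγ⟩ := hpath.joinedIn _ (mem_connectedComponentIn hpA) _
    (heq ▸ mem_connectedComponentIn hqA)
  have hdisj : Disjoint (Set.range (e ∘ γ)) (e '' F ∪ segment ℝ (e a) (e b)) := by
    have himage : segment ℝ (e a) (e b) = e '' segment ℝ a b :=
      (image_segment ℝ e.toLinearEquiv.toLinearMap.toAffineMap a b).symm
    rw [himage, ← Set.image_union, Set.range_comp, Set.disjoint_image_iff e.injective,
      Set.disjoint_left]
    rintro _ ⟨t, rfl⟩ h
    exact connectedComponentIn_subset _ _ (hγ t) h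
  have hγc : Continuous (e ∘ γ) := e.continuous.comp γ.continuous
  refine separates_of_isPreconnected_union_segment (hF'.image e e.continuous.continuousOn)
    (Set.mem_image_of_mem e ha) (Set.mem_image_of_mem e hb) heab hs0 hs1 hε ?_
    (isCompact_range hγc) (isPreconnected_range hγc) hdisj
    ⟨0, by simp only [Function.comp_apply, γ.source, heg]⟩
    ⟨1, by simp only [Function.comp_apply, γ.target, heg]⟩
  intro t ht hmem
  rw [← heg, e.injective.mem_set_image] at hmem
  exact hεF t ht hmem

lemma exists_orthogonal_direction {n : EuclideanSpace ℝ (Fin 2)} (hn : n ≠ 0) :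
    ∃ v : EuclideanSpace ℝ (Fin 2), v ≠ 0 ∧ inner ℝ n v = 0 ∧
      ∀ x : EuclideanSpace ℝ (Fin 2), inner ℝ n x = 0 → ∃ t : ℝ, x = t • v := by
  have hN : 0 < n 0 * n 0 + n 1 * n 1 := by
    have h := real_inner_self_pos.2 hn
    simpa only [PiLp.inner_apply, Fin.sum_univ_two, RCLike.inner_apply, conj_trivial] using h
  refine ⟨!₂[-n 1, n 0], fun h ↦ ?_, ?_, fun x hx ↦
    ⟨(n 0 * x 1 - n 1 * x 0) / (n 0 * n 0 + n 1 * n 1), ?_⟩⟩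
  · have h0 := congrFun (congrArg WithLp.ofLp h) 0
    have h1 := congrFun (congrArg WithLp.ofLp h) 1
    simp at h0 h1
    simp [h0, h1] at hN
  · simp [PiLp.inner_apply, Fin.sum_univ_two]
    ring
  · simp [PiLp.inner_apply, Fin.sum_univ_two] at hx
    ext i
    fin_cases i
    · simp
      rw [div_mul_eq_mul_div, ← neg_div, eq_div_iff hN.ne']
      linear_combination n 0 * hx
    · simp
      rw [div_mul_eq_mul_div, eq_div_iff hN.ne']
      linear_combination n 1 * hx

lemma exists_supporting_segment {F : Set (EuclideanSpace ℝ (Fin 2))}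
    (hcomp : IsCompact F) (hconn : IsPreconnected F) {z n : EuclideanSpace ℝ (Fin 2)}
    (hz : z ∈ closure (convexHull ℝ F)) (hzF : z ∉ F) (hn : n ≠ 0)
    (hsupp : ∀ x ∈ convexHull ℝ F, inner ℝ n x ≤ inner ℝ n z) :
    ∃ p ∈ F, ∃ q ∈ F, p ≠ q ∧ z ∈ segment ℝ p q ∧
      segment ℝ p q ⊆ {x | inner ℝ n x = inner ℝ n z} ∧
      HasBoundedComponent (F ∪ segment ℝ p q)ᶜ := by
  obtain ⟨v, hv, hnv, hspan⟩ := exists_orthogonal_direction hn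
  have hv' : 0 < inner ℝ v v := real_inner_self_pos.2 hv
  have hline : ∀ x, inner ℝ n x = inner ℝ n z → ∃ t : ℝ, x = z + t • v := by
    intro x hx
    obtain ⟨t, ht⟩ := hspan (x - z) (by rw [inner_sub_right, hx, sub_self])
    exact ⟨t, by rw [← ht]; abel⟩
  have hne : ∀ t : ℝ, z + t • v ∈ F → t ≠ 0 := by
    rintro t ht rfl
    exact hzF (by simpa using ht)
  have hsuppF : ∀ x ∈ F, inner ℝ n x ≤ inner ℝ n z := fun x hx ↦
    hsupp x (subset_convexHull ℝ F hx)
  -- The directions `v` and `-v` give a point on each side of `z`, strictly because `z ∉ F`.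
  obtain ⟨q, hqF, hqn, hqv⟩ := exists_mem_inner_eq_of_mem_closure_convexHull hcomp v hz hsuppF
  obtain ⟨p, hpF, hpn, hpv⟩ := exists_mem_inner_eq_of_mem_closure_convexHull hcomp (-v) hz hsuppF
  obtain ⟨r, rfl⟩ := hline q hqn
  obtain ⟨l, rfl⟩ := hline p hpn
  simp only [inner_neg_left, inner_add_right, inner_smul_right] at hqv hpv
  have hr : 0 < r := lt_of_le_of_ne (by nlinarith) (hne r hqF).symm
  have hl : l < 0 := lt_of_le_of_ne (by nlinarith) (hne l hpF)
  have hzseg : z ∈ openSegment ℝ (z + l • v) (z + r • v) := by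
    have hrl : r - l ≠ 0 := by linarith
    refine ⟨r / (r - l), -l / (r - l), div_pos hr (by linarith),
      div_pos (by linarith) (by linarith), by field_simp; ring, ?_⟩
    have h1 : r / (r - l) + -l / (r - l) = 1 := by field_simp; ring
    have h2 : r / (r - l) * l + -l / (r - l) * r = 0 := by field_simp; ring
    calc (r / (r - l)) • (z + l • v) + (-l / (r - l)) • (z + r • v)
        = (r / (r - l) + -l / (r - l)) • z + (r / (r - l) * l + -l / (r - l) * r) • v := by
          module
      _ = z := by rw [h1, h2, one_smul, zero_smul, add_zero]
  refine ⟨z + l • v, hpF, z + r • v, hqF, fun h ↦ ?_, openSegment_subset_segment ℝ _ _ hzseg, ?_,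
    hasBoundedComponent_compl_union_segment hcomp hconn hpF hqF hzseg hzF⟩
  · have h' := smul_left_injective ℝ hv (add_left_cancel h)
    linarith
  · rintro _ ⟨α, β, -, -, hαβ, rfl⟩
    rw [Set.mem_ofPred_eq, inner_add_right, inner_smul_right, inner_smul_right, hpn, hqn,
      ← add_mul, hαβ, one_mul]

lemma collinear_setOf_inner_eq {n : EuclideanSpace ℝ (Fin 2)} (hn : n ≠ 0) (c : ℝ) :
    Collinear ℝ {x : EuclideanSpace ℝ (Fin 2) | inner ℝ n x = c} := by
  rcases Set.eq_empty_or_nonempty {x : EuclideanSpace ℝ (Fin 2) | inner ℝ n x = c} with h | ⟨z, hz⟩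
  · rw [h]
    exact collinear_empty ℝ _
  · obtain ⟨v, -, -, hspan⟩ := exists_orthogonal_direction hn
    rw [collinear_iff_of_mem hz]
    refine ⟨v, fun x hx ↦ ?_⟩
    obtain ⟨t, ht⟩ := hspan (x - z) (by
      rw [Set.mem_ofPred_eq] at hx hz
      rw [inner_sub_right, hx, hz, sub_self])
    exact ⟨t, by rw [← ht, vadd_eq_add, sub_add_cancel]⟩

theorem proposition3p3 (F : Set (EuclideanSpace ℝ (Fin 2)))
    (hcomp : IsCompact F) (hconn : IsConnected F) (hint : interior F = ∅)
    (hline : ¬ Collinear ℝ F) :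
    (∃ K : Set (EuclideanSpace ℝ (Fin 2)),
      IsCompact K ∧ Collinear ℝ K ∧ HasBoundedComponent (F ∪ K)ᶜ) ∧
    (¬ HasBoundedComponent Fᶜ →
      ∃ z ∈ frontier (convexHull ℝ F) \ F, ∃ L : Set (EuclideanSpace ℝ (Fin 2)),
        IsSupportingLine (convexHull ℝ F) L ∧ z ∈ L ∧
        ∃ p q : EuclideanSpace ℝ (Fin 2), p ≠ q ∧ z ∈ segment ℝ p q ∧ segment ℝ p q ⊆ L ∧
          HasBoundedComponent (F ∪ segment ℝ p q)ᶜ) := by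
  have main : ¬ HasBoundedComponent Fᶜ →
      ∃ z ∈ frontier (convexHull ℝ F) \ F, ∃ L : Set (EuclideanSpace ℝ (Fin 2)),
        IsSupportingLine (convexHull ℝ F) L ∧ z ∈ L ∧
        ∃ p q : EuclideanSpace ℝ (Fin 2), p ≠ q ∧ z ∈ segment ℝ p q ∧ segment ℝ p q ⊆ L ∧
          HasBoundedComponent (F ∪ segment ℝ p q)ᶜ := by
    intro hF
    have hci := interior_convexHull_nonempty_of_not_collinear hconn.nonempty hline
    obtain ⟨z, hz, hzF⟩ : ∃ z ∈ frontier (convexHull ℝ F), z ∉ F := by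
      by_contra! hcon
      exact hF (hasBoundedComponent_compl_of_frontier_subset hint
        (isBounded_convexHull.2 hcomp.isBounded) hci hcon)
    obtain ⟨n, hn, hsupp⟩ := exists_inner_le_of_mem_frontier (convex_convexHull ℝ F) hci hz
    obtain ⟨p, hp, q, hq, hpq, hzpq, hL, hb⟩ :=
      exists_supporting_segment hcomp hconn.isPreconnected hz.1 hzF hn hsupp
    have hzc : z ∈ convexHull ℝ F := segment_subset_convexHull hp hq hzpq
    exact ⟨z, ⟨hz, hzF⟩, {x | inner ℝ n x = inner ℝ n z},
      ⟨n, inner ℝ n z, hn, rfl, ⟨z, hzc, rfl⟩, hsupp⟩, rfl, p, q, hpq, hzpq, hL, hb⟩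
  refine ⟨?_, main⟩
  by_cases hF : HasBoundedComponent Fᶜ
  · exact ⟨∅, isCompact_empty, collinear_empty ℝ _, by rwa [Set.union_empty]⟩
  · obtain ⟨z, -, L, ⟨n, c, hn, rfl, -, -⟩, -, p, q, -, -, hL, hb⟩ := main hF
    refine ⟨segment ℝ p q, ?_, (collinear_setOf_inner_eq hn c).subset hL, hb⟩
    rw [segment_eq_image']
    exact isCompact_Icc.image (by fun_prop)
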